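/- Let $\Gamma$ be a hyperbolic group, let $S$ be a finite set of generators of $\Gamma$ with word length $\|\cdot\|_S$ and word distance $d_S(g,h)=\|g^{-1}h\|_S$, and let $\Gamma$ act by isometries on a nonempty metric space $(X,d)$. (Here $\Gamma$ is called hyperbolic if for some finite set of generators $T$ and some $\delta$ one has $\langle g,k\rangle\ge\min(\langle g,h\rangle,\langle h,k\rangle)-\delta$ for all $g,h,k\in\Gamma$, where $\langle g,h\rangle=\tfrac12(\|g\|_T+\|h\|_T-d_T(g,h))$.) Suppose that the orbit maps are quasi-isometric embeddings: for every $x\in X$ there are constants $A>0$ and $B\ge 0$ with $$A^{-1}d_S(g,h)-B\le d(gx,hx)\le A\,d_S(g,h)+B\qquad\text{for all } g,h\in\Gamma.$$ Then the action is well displacing: there are constants $A>0$ and $B>0$ such that for all $\gamma\in\Gamma$ $$\inf_{x\in X}d(x,\gamma x)\ \ge\ A\,\ell_S(\gamma)-B,\qquad \ell_S(\gamma)=\inf_{\eta\in\Gamma}\|\eta\gamma\eta^{-1}\|_S .$$ -/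

import Mathlib

noncomputable section

/-- `S` is a finite set of generators of the group `Γ`. -/
def IsFiniteGeneratingSet {Γ : Type*} [Group Γ] (S : Set Γ) : Prop :=
  S.Finite ∧ Subgroup.closure S = ⊤

/-- The word length `‖g‖_S`: the least length of a word in the letters `S ∪ S⁻¹` that
represents `g`. -/
def wordLength {Γ : Type*} [Group Γ] (S : Set Γ) (g : Γ) : ℕ :=
  sInf {n : ℕ | ∃ w : List Γ, (∀ s ∈ w, s ∈ S ∨ s⁻¹ ∈ S) ∧ w.prod = g ∧ w.length = n}

/-- The (left-invariant) word distance `d_S(g, h) = ‖g⁻¹ h‖_S`, i.e. the distance between the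
vertices `g` and `h` of the Cayley graph. -/
def wordDist {Γ : Type*} [Group Γ] (S : Set Γ) (g h : Γ) : ℝ :=
  (wordLength S (g⁻¹ * h) : ℝ)

/-- The Gromov product `⟨g, h⟩_u` based at `u`, for the word distance. -/
def gromovProduct {Γ : Type*} [Group Γ] (S : Set Γ) (u g h : Γ) : ℝ :=
  (wordDist S g u + wordDist S h u - wordDist S g h) / 2

/-- `Γ` with the word distance of `S` is `δ`-hyperbolic. By left invariance of the word
distance it is enough to use Gromov products based at `1`. -/
def IsDeltaHyperbolic {Γ : Type*} [Group Γ] (S : Set Γ) (δ : ℝ) : Prop :=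
  ∀ g h k : Γ,
    min (gromovProduct S 1 g h) (gromovProduct S 1 h k) - δ ≤ gromovProduct S 1 g k

/-- `Γ` is a hyperbolic group: it has a finite set of generators whose word distance is
`δ`-hyperbolic for some `δ`. -/
def IsHyperbolicGroup (Γ : Type*) [Group Γ] : Prop :=
  ∃ S : Set Γ, IsFiniteGeneratingSet S ∧ ∃ δ : ℝ, IsDeltaHyperbolic S δ

/-- The translation length `ℓ_S(γ) = inf_η ‖η γ η⁻¹‖_S`. -/
def translationLength {Γ : Type*} [Group Γ] (S : Set Γ) (γ : Γ) : ℕ :=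
  ⨅ η : Γ, wordLength S (η * γ * η⁻¹)

/-- The displacement `d_X(γ) = inf_x d(x, γ x)` of `γ` acting on `X`. -/
def displacement {Γ : Type*} (X : Type*) [Group Γ] [MetricSpace X] [MulAction Γ X] (γ : Γ) : ℝ :=
  ⨅ x : X, dist x (γ • x)

/-- `f` is a quasi-isometric embedding of `Γ`, with the word distance of `S`, into `X`. -/
def IsQuasiIsometricEmbedding {Γ X : Type*} [Group Γ] [MetricSpace X] (S : Set Γ)
    (f : Γ → X) : Prop :=
  ∃ A B : ℝ, 0 < A ∧ 0 ≤ B ∧ ∀ g h : Γ,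
    A⁻¹ * wordDist S g h - B ≤ dist (f g) (f h) ∧ dist (f g) (f h) ≤ A * wordDist S g h + B

/-- The action of `Γ` on `X` is well displacing, with respect to the set of generators `S`. -/
def IsWellDisplacing {Γ : Type*} (X : Type*) [Group Γ] [MetricSpace X] [MulAction Γ X]
    (S : Set Γ) : Prop :=
  ∃ A B : ℝ, 0 < A ∧ 0 < B ∧ ∀ γ : Γ,
    A * (translationLength S γ : ℝ) - B ≤ displacement X γ

end

/-! The argument passes through stable length, the growth rate of `‖γ ^ n‖`. In a hyperbolic group
it is at least the translation length minus a constant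
(`IsDeltaHyperbolic.mul_translationLength_le`): a shortest conjugate that is not short has a square
almost twice as long, and the four-point inequality propagates this to all powers. A quasi-isometric
orbit map gives `d(x₀, γⁿx₀)` the same linear growth, while `d(x, γⁿx) ≤ n d(x, γx)`. Comparing
slopes in `n` removes every constant that depends on `x` or `γ`. -/

section WordLength

variable {Γ : Type*} [Group Γ] {S : Set Γ}

lemma wordLength_prod_le {w : List Γ} (hw : ∀ s ∈ w, s ∈ S ∨ s⁻¹ ∈ S) :
    wordLength S w.prod ≤ w.length :=
  Nat.sInf_le ⟨w, hw, rfl, rfl⟩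

lemma wordLength_one : wordLength S (1 : Γ) = 0 := by
  simpa using wordLength_prod_le (S := S) (w := []) (by simp)

/-- A word of minimal length representing `g`. -/
lemma exists_word_length_eq_wordLength (hS : Subgroup.closure S = ⊤) (g : Γ) :
    ∃ w : List Γ, (∀ s ∈ w, s ∈ S ∨ s⁻¹ ∈ S) ∧ w.prod = g ∧ w.length = wordLength S g := by
  have hg : g ∈ Subgroup.closure S := hS ▸ Subgroup.mem_top g
  rw [← Subgroup.mem_toSubmonoid, Subgroup.closure_toSubmonoid] at hg
  obtain ⟨w, hw, hwg⟩ := Submonoid.exists_list_of_mem_closure hg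
  exact Nat.sInf_mem (s := {n : ℕ | ∃ w : List Γ, (∀ s ∈ w, s ∈ S ∨ s⁻¹ ∈ S) ∧
    w.prod = g ∧ w.length = n}) ⟨w.length, w, hw, hwg, rfl⟩

lemma wordLength_mul_le (hS : Subgroup.closure S = ⊤) (g h : Γ) :
    wordLength S (g * h) ≤ wordLength S g + wordLength S h := by
  obtain ⟨v, hv, rfl, hvl⟩ := exists_word_length_eq_wordLength hS g
  obtain ⟨w, hw, rfl, hwl⟩ := exists_word_length_eq_wordLength hS h
  rw [← hvl, ← hwl, ← List.prod_append, ← List.length_append]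
  refine wordLength_prod_le fun s hs => ?_
  rcases List.mem_append.1 hs with hs | hs
  exacts [hv s hs, hw s hs]

lemma wordLength_inv_le (hS : Subgroup.closure S = ⊤) (g : Γ) :
    wordLength S g⁻¹ ≤ wordLength S g := by
  obtain ⟨w, hw, rfl, hwl⟩ := exists_word_length_eq_wordLength hS g
  rw [← hwl, List.prod_inv_reverse]
  refine (wordLength_prod_le fun s hs => ?_).trans_eq (by simp)
  obtain ⟨t, ht, rfl⟩ := List.mem_map.1 (List.mem_reverse.1 hs)
  simpa using (hw t ht).symm

lemma wordLength_inv (hS : Subgroup.closure S = ⊤) (g : Γ) :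
    wordLength S g⁻¹ = wordLength S g :=
  (wordLength_inv_le hS g).antisymm (by simpa using wordLength_inv_le hS g⁻¹)

/-- A group element splits as a product along a geodesic word, at any prescribed length. -/
lemma exists_mul_eq_wordLength_add (hS : Subgroup.closure S = ⊤) (g : Γ) {n : ℕ}
    (hn : n ≤ wordLength S g) :
    ∃ u v : Γ, u * v = g ∧ wordLength S u = n ∧ wordLength S v + n = wordLength S g := by
  obtain ⟨w, hw, hwg, hwl⟩ := exists_word_length_eq_wordLength hS g
  have hu : wordLength S (w.take n).prod ≤ n :=
    (wordLength_prod_le fun s hs => hw s (List.mem_of_mem_take hs)).trans (by simp)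
  have hv : wordLength S (w.drop n).prod ≤ wordLength S g - n :=
    (wordLength_prod_le fun s hs => hw s (List.mem_of_mem_drop hs)).trans (by simp [hwl])
  have huv : (w.take n).prod * (w.drop n).prod = g := by rw [List.prod_take_mul_prod_drop, hwg]
  have hle := wordLength_mul_le hS (w.take n).prod (w.drop n).prod
  rw [huv] at hle
  exact ⟨_, _, huv, by omega, by omega⟩

/-- Word lengths for a finite set and for a generating set are comparable. -/
lemma exists_wordLength_le_mul {T : Set Γ} (hS : IsFiniteGeneratingSet S)
    (hT : Subgroup.closure T = ⊤) :
    ∃ L : ℕ, 0 < L ∧ ∀ g : Γ, wordLength T g ≤ L * wordLength S g := by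
  obtain ⟨L, hL⟩ := (hS.1.image (wordLength T)).bddAbove
  have hmem : ∀ s ∈ S, wordLength T s ≤ L + 1 := fun s hs =>
    (hL (Set.mem_image_of_mem _ hs)).trans L.le_succ
  -- The successor keeps the constant positive even if the bound is `0`; it is later inverted.
  refine ⟨L + 1, L.succ_pos, fun g => ?_⟩
  obtain ⟨w, hw, rfl, hwl⟩ := exists_word_length_eq_wordLength hS.2 g
  rw [← hwl]
  clear hwl
  induction w with
  | nil => simp [wordLength_one]
  | cons s w ih =>
    have hs : wordLength T s ≤ L + 1 := by
      rcases hw s (by simp) with h | h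
      · exact hmem s h
      · simpa [wordLength_inv hT] using hmem _ h
    have hw' := ih fun t ht => hw t (List.mem_cons_of_mem _ ht)
    rw [List.prod_cons, List.length_cons]
    linarith [wordLength_mul_le hT s w.prod]

lemma exists_wordLength_conj_eq_translationLength (S : Set Γ) (γ : Γ) :
    ∃ η : Γ, wordLength S (η * γ * η⁻¹) = translationLength S γ :=
  Nat.sInf_mem (Set.range_nonempty fun η : Γ => wordLength S (η * γ * η⁻¹))

lemma translationLength_le (S : Set Γ) (γ η : Γ) :
    translationLength S γ ≤ wordLength S (η * γ * η⁻¹) :=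
  Nat.sInf_le (Set.mem_range_self η)

lemma translationLength_le_mul {T : Set Γ} {L : ℕ}
    (hL : ∀ g : Γ, wordLength S g ≤ L * wordLength T g) (γ : Γ) :
    translationLength S γ ≤ L * translationLength T γ := by
  obtain ⟨η, hη⟩ := exists_wordLength_conj_eq_translationLength T γ
  exact hη ▸ (translationLength_le S γ η).trans (hL _)

end WordLength

section Hyperbolic

variable {Γ : Type*} [Group Γ] {T : Set Γ} {δ : ℝ}

lemma IsDeltaHyperbolic.nonneg (h : IsDeltaHyperbolic T δ) : 0 ≤ δ := by
  have := h 1 1 1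
  simp only [min_self] at this
  linarith

/-- The four-point inequality for the word distance. -/
lemma IsDeltaHyperbolic.four_point (hT : Subgroup.closure T = ⊤) (h : IsDeltaHyperbolic T δ)
    (u a b c : Γ) :
    (wordLength T (u⁻¹ * b) : ℝ) + wordLength T (a⁻¹ * c) ≤
      max (wordLength T (u⁻¹ * c) + wordLength T (a⁻¹ * b) : ℝ)
        (wordLength T (u⁻¹ * a) + wordLength T (b⁻¹ * c)) + 2 * δ := by
  have key := h (u⁻¹ * a) (u⁻¹ * b) (u⁻¹ * c)
  have cancel (x y : Γ) : (u⁻¹ * x)⁻¹ * (u⁻¹ * y) = x⁻¹ * y := by group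
  simp only [gromovProduct, wordDist, cancel, mul_one, wordLength_inv hT] at key
  rw [← sub_le_iff_le_add, le_max_iff]
  rcases le_total
    (((wordLength T (u⁻¹ * a) : ℝ) + wordLength T (u⁻¹ * b) - wordLength T (a⁻¹ * b)) / 2)
    ((wordLength T (u⁻¹ * b) + wordLength T (u⁻¹ * c) - wordLength T (b⁻¹ * c)) / 2) with hle | hle
  · rw [min_eq_left hle] at key
    left; linarith
  · rw [min_eq_right hle] at key
    right; linarith

/-- The length of the powers of `g` grows at least linearly, with slope `‖g²‖ - ‖g‖ - 2δ`. -/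
lemma IsDeltaHyperbolic.mul_le_wordLength_pow (hT : Subgroup.closure T = ⊤)
    (h : IsDeltaHyperbolic T δ) (g : Γ) (n : ℕ) :
    n * ((wordLength T (g ^ 2) : ℝ) - wordLength T g - 2 * δ) ≤ wordLength T (g ^ n) := by
  set c : ℝ := (wordLength T (g ^ 2) : ℝ) - wordLength T g - 2 * δ with hc
  rcases le_or_gt c 0 with hc0 | hc0
  · exact (mul_nonpos_of_nonneg_of_nonpos n.cast_nonneg hc0).trans (Nat.cast_nonneg _)
  have step : ∀ m : ℕ, (wordLength T (g ^ m) : ℝ) + c ≤ wordLength T (g ^ (m + 1)) := by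
    intro m
    induction m with
    | zero =>
      have h2 : (wordLength T (g ^ 2) : ℝ) ≤ wordLength T g + wordLength T g := by
        rw [pow_two]; exact_mod_cast wordLength_mul_le hT g g
      have := h.nonneg
      simp only [pow_zero, wordLength_one, zero_add, pow_one, Nat.cast_zero]
      linarith
    | succ m ih =>
      have key := h.four_point hT 1 g (g ^ 2) (g ^ (m + 2))
      have e1 : g⁻¹ * g ^ (m + 2) = g ^ (m + 1) := by rw [pow_succ' g (m + 1)]; group
      have e2 : g⁻¹ * g ^ 2 = g := by group
      have e3 : (g ^ 2)⁻¹ * g ^ (m + 2) = g ^ m := by rw [add_comm, pow_add]; group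
      rw [e1, e2, e3, inv_one, one_mul, one_mul, one_mul, ← sub_le_iff_le_add, le_max_iff] at key
      -- The second alternative says `‖g ^ (m+1)‖ + c ≤ ‖g ^ m‖`; with `ih` this contradicts `c >
      -- 0`.
      rcases key with key | key <;> linarith
  induction n with
  | zero => simp
  | succ n ih =>
    push_cast
    linarith [step n]

/-- A shortest element of a conjugacy class is either short, or has an almost twice as long
square. -/
lemma IsDeltaHyperbolic.wordLength_le_or_two_mul_wordLength_le (hT : Subgroup.closure T = ⊤)
    (h : IsDeltaHyperbolic T δ) {g : Γ}
    (hg : ∀ η : Γ, wordLength T g ≤ wordLength T (η * g * η⁻¹)) :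
    (wordLength T g : ℝ) ≤ 4 * δ + 1 ∨
      2 * (wordLength T g : ℝ) ≤ wordLength T (g ^ 2) + 4 * δ := by
  -- `u` is the midpoint of a geodesic from `1` to `g`. Minimality gives `d(u, gu) ≥ ‖g‖`, so by
  -- `k1` a long `g` has `‖gu‖` about `3‖g‖/2`; then `k2` bounds `‖g ^ 2‖` below. The `+ 1` in the
  -- short case comes from odd `‖g‖`.
  obtain ⟨u, v, huv, hu, hv⟩ := exists_mul_eq_wordLength_add hT g (Nat.div_le_self _ 2)
  have hconj := hg u⁻¹
  rw [inv_inv] at hconj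
  have k1 := h.four_point hT g u 1 (g * u)
  have k2 := h.four_point hT g 1 (g ^ 2) (g * u)
  have e1 : g⁻¹ * u = v⁻¹ := by rw [← huv]; group
  have e2 : g⁻¹ * (g * u) = u := by group
  have e3 : u⁻¹ * (g * u) = u⁻¹ * g * u := by group
  have e4 : g⁻¹ * g ^ 2 = g := by group
  have e5 : (g ^ 2)⁻¹ * (g * u) = v⁻¹ := by rw [← e1]; group
  simp only [e1, e2, e3, e4, e5, mul_one, inv_one, one_mul, wordLength_inv hT] at k1 k2
  have hδ := h.nonneg
  have hu2 : 2 * wordLength T u ≤ wordLength T g := by omega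
  have hu3 : wordLength T g ≤ 2 * wordLength T u + 1 := by omega
  have hv' : wordLength T v + wordLength T u = wordLength T g := by omega
  have hu2' : 2 * (wordLength T u : ℝ) ≤ wordLength T g := by exact_mod_cast hu2
  have hu3' : (wordLength T g : ℝ) ≤ 2 * wordLength T u + 1 := by exact_mod_cast hu3
  have hv'' : (wordLength T v : ℝ) + wordLength T u = wordLength T g := by exact_mod_cast hv'
  have hconj' : (wordLength T g : ℝ) ≤ wordLength T (u⁻¹ * g * u) := by exact_mod_cast hconj
  rw [← sub_le_iff_le_add, le_max_iff] at k1 k2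
  rcases k1 with k1 | k1
  · left; linarith
  · rcases k2 with k2 | k2
    · right; linarith
    · left; linarith

/-- In a hyperbolic group, the translation length is bounded by the stable length up to an
additive constant. -/
lemma IsDeltaHyperbolic.mul_translationLength_le (hT : Subgroup.closure T = ⊤)
    (h : IsDeltaHyperbolic T δ) (γ : Γ) :
    ∃ K : ℝ, ∀ n : ℕ,
      n * ((translationLength T γ : ℝ) - (6 * δ + 1)) ≤ wordLength T (γ ^ n) + K := by
  obtain ⟨η, hη⟩ := exists_wordLength_conj_eq_translationLength T γ
  have hmin : ∀ ξ : Γ, wordLength T (η * γ * η⁻¹) ≤ wordLength T (ξ * (η * γ * η⁻¹) * ξ⁻¹) := by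
    intro ξ
    rw [hη]
    convert translationLength_le T γ (ξ * η) using 2
    group
  have hδ := h.nonneg
  -- Conjugating by `η` costs at most `2‖η‖`, uniformly in `n`.
  refine ⟨2 * wordLength T η, fun n => ?_⟩
  have hpow : (wordLength T ((η * γ * η⁻¹) ^ n) : ℝ) ≤
      wordLength T (γ ^ n) + 2 * wordLength T η := by
    rw [conj_pow]
    have h1 := wordLength_mul_le hT (η * γ ^ n) η⁻¹
    have h2 := wordLength_mul_le hT η (γ ^ n)
    rw [wordLength_inv hT] at h1
    exact_mod_cast (by omega : wordLength T (η * γ ^ n * η⁻¹) ≤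
      wordLength T (γ ^ n) + 2 * wordLength T η)
  rw [← hη]
  rcases h.wordLength_le_or_two_mul_wordLength_le hT hmin with hs | hs
  · have : (n : ℝ) * ((wordLength T (η * γ * η⁻¹) : ℝ) - (6 * δ + 1)) ≤ 0 :=
      mul_nonpos_of_nonneg_of_nonpos n.cast_nonneg (by linarith)
    have : (0 : ℝ) ≤ wordLength T (γ ^ n) + 2 * wordLength T η := by positivity
    linarith
  · refine le_trans ?_ ((h.mul_le_wordLength_pow hT _ n).trans hpow)
    -- Here `6δ = 4δ + 2δ`: the defect of the square plus the loss in the slope.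
    exact mul_le_mul_of_nonneg_left (by linarith) n.cast_nonneg

end Hyperbolic

lemma dist_pow_smul_le {Γ X : Type*} [Group Γ] [MetricSpace X] [MulAction Γ X]
    [IsIsometricSMul Γ X] (γ : Γ) (x : X) (n : ℕ) :
    dist x (γ ^ n • x) ≤ n * dist x (γ • x) := by
  induction n with
  | zero => simp
  | succ n ih =>
    have h1 : dist (γ ^ n • x) (γ ^ (n + 1) • x) = dist x (γ • x) := by
      rw [pow_succ, mul_smul, dist_smul]
    have h2 := dist_triangle x (γ ^ n • x) (γ ^ (n + 1) • x)
    push_cast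
    linarith

lemma nonpos_of_forall_nat_mul_le {a K : ℝ} (h : ∀ n : ℕ, n * a ≤ K) : a ≤ 0 := by
  by_contra! ha
  obtain ⟨n, hn⟩ := exists_nat_gt (K / a)
  rw [div_lt_iff₀ ha] at hn
  exact (h n).not_gt hn

theorem corollary3p0p3 {Γ X : Type*} [Group Γ] [MetricSpace X] [Nonempty X]
    [MulAction Γ X] [IsIsometricSMul Γ X]
    (hΓ : IsHyperbolicGroup Γ)
    (S : Set Γ) (hS : IsFiniteGeneratingSet S)
    (hqi : ∀ x : X, IsQuasiIsometricEmbedding S (fun g : Γ => g • x)) :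
    IsWellDisplacing X S := by
  obtain ⟨T, hT, δ, hδ⟩ := hΓ
  obtain ⟨L, hL0, hL⟩ := exists_wordLength_le_mul hT hS.2
  obtain ⟨M, hM0, hM⟩ := exists_wordLength_le_mul hS hT.2
  obtain ⟨x₀⟩ := ‹Nonempty X›
  obtain ⟨A, B, hA, -, hAB⟩ := hqi x₀
  have hL0' : (0 : ℝ) < L := by exact_mod_cast hL0
  have hM0' : (0 : ℝ) < M := by exact_mod_cast hM0
  have hδ0 := hδ.nonneg
  refine ⟨(L * (M * A))⁻¹, (6 * δ + 1) / (M * A), by positivity, by positivity, fun γ => ?_⟩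
  have : Nonempty X := ⟨x₀⟩
  refine le_ciInf fun x => ?_
  obtain ⟨K, hK⟩ := hδ.mul_translationLength_le hT.2 γ
  -- Only the basepoint `x₀` needs the quasi-isometry constants: moving to `x` costs `2 d(x₀, x)`,
  -- which is independent of `n`.
  have hstable : (translationLength T γ : ℝ) - (6 * δ + 1) - M * A * dist x (γ • x) ≤ 0 := by
    refine nonpos_of_forall_nat_mul_le (K := K + M * A * (2 * dist x₀ x + B)) fun n => ?_
    have hlower : (wordLength S (γ ^ n) : ℝ) ≤ A * (dist x₀ (γ ^ n • x₀) + B) := by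
      have := (hAB 1 (γ ^ n)).1
      simp only [wordDist, inv_one, one_mul, one_smul] at this
      rwa [sub_le_iff_le_add, inv_mul_le_iff₀ hA] at this
    have hupper : dist x₀ (γ ^ n • x₀) ≤ 2 * dist x₀ x + n * dist x (γ • x) := by
      have h1 := dist_triangle4 x₀ x (γ ^ n • x) (γ ^ n • x₀)
      rw [dist_smul, dist_comm x x₀] at h1
      linarith [dist_pow_smul_le γ x n]
    have hcompare : (wordLength T (γ ^ n) : ℝ) ≤ M * wordLength S (γ ^ n) := by
      exact_mod_cast hM (γ ^ n)
    calc (n : ℝ) * ((translationLength T γ : ℝ) - (6 * δ + 1) - M * A * dist x (γ • x))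
        = n * ((translationLength T γ : ℝ) - (6 * δ + 1)) - M * A * (n * dist x (γ • x)) := by
          ring
      _ ≤ M * (A * (2 * dist x₀ x + n * dist x (γ • x) + B)) + K
            - M * A * (n * dist x (γ • x)) := by
          gcongr
          refine (hK n).trans ?_
          gcongr
          refine hcompare.trans ?_
          gcongr
          refine hlower.trans ?_
          gcongr
      _ = K + M * A * (2 * dist x₀ x + B) := by ring
  have htrans : (translationLength S γ : ℝ) ≤ L * translationLength T γ := by
    exact_mod_cast translationLength_le_mul hL γ
  calc (L * (M * A))⁻¹ * (translationLength S γ : ℝ) - (6 * δ + 1) / (M * A)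
      ≤ (L * (M * A))⁻¹ * (L * translationLength T γ) - (6 * δ + 1) / (M * A) := by gcongr
    _ = (translationLength T γ - (6 * δ + 1)) / (M * A) := by field_simp
    _ ≤ dist x (γ • x) := by
      rw [div_le_iff₀ (by positivity)]
      linarith
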